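/- \textbf{Setting.} Let $K\ge 1$, $[K]=\{1,\dots,K\}$, and let $p_1,\dots,p_K\ge 0$ be probabilities with $\sum_{i=1}^K p_i=1$. Variables are $\mathbf{x}_{\mathbf{y}}=(x;y_1;\dots;y_K)\in\mathbb{R}^{m_1}\times(\mathbb{R}^{m_2})^{K}$. Given are functions $c:\mathbb{R}^{m_1}\to\mathbb{R}$, $q_{\xi_i}:\mathbb{R}^{m_2}\to\mathbb{R}$, $P_1:\mathbb{R}^{l_1}\to\mathbb{R}$, $P_{\xi_i}:\mathbb{R}^{l_{2,i}}\to\mathbb{R}$, matrices $U_1,U_{\xi_i},A,B,A_{1,\xi_i},A_{2,\xi_i},W_{\xi_i},T_{\xi_i}$ and vectors $u_1,u_{\xi_i},a,b,d_{\xi_i},h_{\xi_i}$ of matching dimensions, and closed convex cones $C_1\subseteq\mathbb{R}^{s_1}$, $C_{2,\xi_i}\subseteq\mathbb{R}^{s_2}$ with nonempty interior (for instance symmetric cones such as nonnegative orthants, second-order cones, positive semidefinite cones and their products), $i\in[K]$. Put $$r_1(x)=P_1(U_1x+u_1),\quad r_{\xi_i}(y_i)=P_{\xi_i}(U_{\xi_i}y_i+u_{\xi_i}),$$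 $$\hat f(\mathbf{x}_{\mathbf{y}})=c(x)+\sum_{i=1}^K p_i q_{\xi_i}(y_i),\quad \Psi(\mathbf{x}_{\mathbf{y}})=r_1(x)+\sum_{i=1}^K p_i r_{\xi_i}(y_i),$$ $$\mathcal{U}(\mathbf{x}_{\mathbf{y}})=(U_1x+u_1;\,U_{\xi_i}y_i+u_{\xi_i},\,i\in[K]),\quad P(w;v_1;\dots;v_K)=P_1(w)+\sum_{i=1}^K p_iP_{\xi_i}(v_i),$$ so that $\Psi=P\circ\mathcal{U}$, and $$G(\mathbf{x}_{\mathbf{y}})=\big(Ax-a;\,Bx-b;\,A_{1,\xi_i}y_i+A_{2,\xi_i}x-d_{\xi_i},\,i\in[K];\,W_{\xi_i}y_i+T_{\xi_i}x-h_{\xi_i},\,i\in[K]\big),$$ $$\mathcal{K}=\{0_{n_1}\}\times(-C_1)\times\{0_{n_2}\}^{K}\times\prod_{i=1}^K(-C_{2,\xi_i}).$$ Let $X=\{x: Ax=a,\ Bx-b\in -C_1\}$, $Y(x,\xi_i)=\{y: A_{1,\xi_i}y+A_{2,\xi_i}x=d_{\xi_i},\ W_{\xi_i}y+T_{\xi_i}x-h_{\xi_i}\in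 -C_{2,\xi_i}\}$, $\Phi=\{\mathbf{x}_{\mathbf{y}}: x\in X,\ y_i\in Y(x,\xi_i),\ i\in[K]\}=\{\mathbf{x}_{\mathbf{y}}: G(\mathbf{x}_{\mathbf{y}})\in\mathcal{K}\}$, and $\vartheta(x,\xi_i)=\inf_{y\in Y(x,\xi_i)}\,(q_{\xi_i}(y)+r_{\xi_i}(y))\in[-\infty,+\infty]$. The problem is $$\min_{\mathbf{x}_{\mathbf{y}}}\ \hat f(\mathbf{x}_{\mathbf{y}})+\Psi(\mathbf{x}_{\mathbf{y}})\quad\text{s.t. } G(\mathbf{x}_{\mathbf{y}})\in\mathcal{K}.\tag{1}$$ \textbf{Standing assumptions.} (A1) $P_1$ and all $P_{\xi_i}$ are lower semicontinuous and bounded from below. (A2) $c$ and all $q_{\xi_i}$ are convex and twice continuously differentiable. (A3) $\Phi$ is compact. (A4) $\sum_{i=1}^K p_i|\vartheta(x,\xi_i)|<+\infty$ for every $x\in X$ (with $0\cdot\infty=0$). (A5) There is $(\mathring x,\mathring y_1,\dots,\mathring y_K)$ with $A\mathring x=a$, $A_{1,\xi_i}\mathring y_i+A_{2,\xi_i}\mathring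 x=d_{\xi_i}$, $B\mathring x-b\in\operatorname{int}(-C_1)$ and $W_{\xi_i}\mathring y_i+T_{\xi_i}\mathring x-h_{\xi_i}\in\operatorname{int}(-C_{2,\xi_i})$ for all $i\in[K]$. \textbf{Notation.} For $f:\mathbb{R}^n\to\mathbb{R}$, the Fréchet subdifferential is $\hat\partial f(\bar w)=\{v: \liminf_{w\to\bar w,\,w\ne\bar w}\frac{f(w)-f(\bar w)-v^T(w-\bar w)}{\|w-\bar w\|}\ge 0\}$. The limiting subdifferential $\partial f(\bar w)$ consists of all limits of sequences $v^k\in\hat\partial f(w^k)$ with $w^k\to\bar w$ and $f(w^k)\to f(\bar w)$. The horizon subdifferential $\partial^\infty f(\bar w)$ consists of all limits of $\alpha^kv^k$ with such $w^k$, $v^k\in\hat\partial f(w^k)$, and $\alpha^k>0$, $\alpha^k\to0$. For a set $S$ and $\bar w\in S$, the normal cone $N_S(\bar w)$ is the limiting (Mordukhovich) one: all limits of $v^k\in\hat N_S(w^k)$ with $w^k\in S$, $w^k\to\bar w$, where $\hat N_S(w)=\{v: v^T(w'-w)\le o(\|w'-w\|)\text{ for } w'\in S\}$. For a differentiable map $L$,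 $\nabla L(w)$ is the transpose of its Jacobian at $w$. \textbf{Theorem.} Under (A1)--(A5), let $\mathbf{x}^*_{\mathbf{y}}$ be a local optimal solution of (1). Suppose that (A6) $-\partial^\infty\Psi(\mathbf{x}^*_{\mathbf{y}})\cap N_\Phi(\mathbf{x}^*_{\mathbf{y}})=\{0\}$, and (A7) if $\lambda\in\partial^\infty P(\mathcal{U}(\mathbf{x}^*_{\mathbf{y}}))$ and $\nabla\mathcal{U}(\mathbf{x}^*_{\mathbf{y}})\lambda=0$, then $\lambda=0$. Then $\mathbf{x}^*_{\mathbf{y}}$ is a KKT point of (1): $\mathbf{x}^*_{\mathbf{y}}\in\Phi$ and there exist $\lambda^*\in\partial P(\mathcal{U}(\mathbf{x}^*_{\mathbf{y}}))$ and $M^*\in N_{\mathcal{K}}(G(\mathbf{x}^*_{\mathbf{y}}))$ such that $$0=\nabla\hat f(\mathbf{x}^*_{\mathbf{y}})+\nabla\mathcal{U}(\mathbf{x}^*_{\mathbf{y}})\lambda^*+\nabla G(\mathbf{x}^*_{\mathbf{y}})M^*.$$ -/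

import Mathlib

open Filter Topology
open scoped Pointwise

noncomputable section

namespace TwoStageSCP

/-! ### Variational analysis -/

section Variational

variable {E : Type*} [NormedAddCommGroup E] [InnerProductSpace ℝ E]

/-- The Fréchet subdifferential of a real-valued function `f` at `w`: the vectors `v` with
`f w' ≥ f w + ⟪v, w' - w⟫ - o(‖w' - w‖)`, that is,
`liminf (f w' - f w - ⟪v, w' - w⟫) / ‖w' - w‖ ≥ 0` as `w' → w`, `w' ≠ w`. -/
def frechetSubdiff (f : E → ℝ) (w : E) : Set E :=
  {v | ∀ ε : ℝ, 0 < ε → ∀ᶠ w' in 𝓝 w, -(ε * ‖w' - w‖) ≤ f w' - f w - inner ℝ v (w' - w)}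

/-- The limiting (Mordukhovich) subdifferential of a real-valued function. -/
def limitingSubdiff (f : E → ℝ) (w : E) : Set E :=
  {v | ∃ (ws vs : ℕ → E), Tendsto ws atTop (𝓝 w) ∧
    Tendsto (fun k => f (ws k)) atTop (𝓝 (f w)) ∧
    (∀ k, vs k ∈ frechetSubdiff f (ws k)) ∧ Tendsto vs atTop (𝓝 v)}

/-- The horizon subdifferential of a real-valued function. -/
def horizonSubdiff (f : E → ℝ) (w : E) : Set E :=
  {v | ∃ (ws vs : ℕ → E) (α : ℕ → ℝ), Tendsto ws atTop (𝓝 w) ∧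
    Tendsto (fun k => f (ws k)) atTop (𝓝 (f w)) ∧
    (∀ k, 0 < α k) ∧ Tendsto α atTop (𝓝 0) ∧
    (∀ k, vs k ∈ frechetSubdiff f (ws k)) ∧ Tendsto (fun k => α k • vs k) atTop (𝓝 v)}

/-- The Fréchet (regular) normal cone to a set `S` at `w` (empty when `w ∉ S`): the vectors `v`
with `⟪v, w' - w⟫ ≤ o(‖w' - w‖)` for `w' ∈ S`. -/
def frechetNormalCone (S : Set E) (w : E) : Set E :=
  {v | w ∈ S ∧ ∀ ε : ℝ, 0 < ε → ∀ᶠ w' in 𝓝[S] w, inner ℝ v (w' - w) ≤ ε * ‖w' - w‖}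

/-- The limiting (Mordukhovich) normal cone to a set `S` at `w` (empty when `w ∉ S`). -/
def limitingNormalCone (S : Set E) (w : E) : Set E :=
  {v | w ∈ S ∧ ∃ (ws vs : ℕ → E), Tendsto ws atTop (𝓝 w) ∧
    (∀ k, vs k ∈ frechetNormalCone S (ws k)) ∧ Tendsto vs atTop (𝓝 v)}

/-- `∇ L (w)`, the transpose (adjoint) of the Jacobian of `L` at `w`. -/
def gradMap {F : Type*} [NormedAddCommGroup F] [InnerProductSpace ℝ F]
    [CompleteSpace E] [CompleteSpace F] (L : E → F) (w : E) : F →L[ℝ] E :=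
  ContinuousLinearMap.adjoint (fderiv ℝ L w)

end Variational

/-! ### The two-stage stochastic conic program -/

/-- `ℝⁿ` with the Euclidean inner product. -/
abbrev Vec (n : ℕ) := EuclideanSpace ℝ (Fin n)

/-- `ℝ^(n 1) × ⋯ × ℝ^(n K)` with the Euclidean inner product. -/
abbrev Vecs {K : ℕ} (n : Fin K → ℕ) := PiLp 2 (fun i : Fin K => Vec (n i))

/-- The product of two Euclidean spaces, with the Euclidean inner product. -/
abbrev Pair (E F : Type) := WithLp 2 (E × F)

/-- The data of the program. `K` is the number of scenarios, `p i` the probability of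
scenario `i`, and an index `i` marks the second-stage data of scenario `i`. -/
structure Data (K m₁ m₂ n₁ n₂ s₁ s₂ l₁ : ℕ) (l₂ : Fin K → ℕ) where
  p : Fin K → ℝ
  c : Vec m₁ → ℝ
  q : Fin K → Vec m₂ → ℝ
  P₁ : Vec l₁ → ℝ
  U₁ : Matrix (Fin l₁) (Fin m₁) ℝ
  u₁ : Vec l₁
  P₂ : (i : Fin K) → Vec (l₂ i) → ℝ
  U₂ : (i : Fin K) → Matrix (Fin (l₂ i)) (Fin m₂) ℝ
  u₂ : (i : Fin K) → Vec (l₂ i)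
  A : Matrix (Fin n₁) (Fin m₁) ℝ
  a : Vec n₁
  B : Matrix (Fin s₁) (Fin m₁) ℝ
  b : Vec s₁
  C₁ : ProperCone ℝ (Vec s₁)
  A₁ : Fin K → Matrix (Fin n₂) (Fin m₂) ℝ
  A₂ : Fin K → Matrix (Fin n₂) (Fin m₁) ℝ
  d : Fin K → Vec n₂
  W : Fin K → Matrix (Fin s₂) (Fin m₂) ℝ
  T : Fin K → Matrix (Fin s₂) (Fin m₁) ℝ
  h : Fin K → Vec s₂
  C₂ : Fin K → ProperCone ℝ (Vec s₂)

namespace Data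

variable {K m₁ m₂ n₁ n₂ s₁ s₂ l₁ : ℕ} {l₂ : Fin K → ℕ}
  (D : Data K m₁ m₂ n₁ n₂ s₁ s₂ l₁ l₂)

/-- The space of the primal variables `(x; y 1; …; y K)`. -/
abbrev Primal (K m₁ m₂ : ℕ) := Pair (Vec m₁) (Vecs (fun _ : Fin K => m₂))

/-- The space of the values of the inner mapping `(U₁ x + u₁; U₂ i (y i) + u₂ i, i ∈ [K])`. -/
abbrev Inner {K : ℕ} (l₁ : ℕ) (l₂ : Fin K → ℕ) := Pair (Vec l₁) (Vecs l₂)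

/-- The space of the values of the constraint mapping, ordered as first-stage equations,
first-stage conic constraints, second-stage equations, second-stage conic constraints. -/
abbrev Dual (K n₁ n₂ s₁ s₂ : ℕ) :=
  Pair (Vec n₁) (Pair (Vec s₁)
    (Pair (Vecs (fun _ : Fin K => n₂)) (Vecs (fun _ : Fin K => s₂))))

/-- The nonsmooth first-stage term `r₁ x = P₁ (U₁ x + u₁)`. -/
def r₁ (x : Vec m₁) : ℝ := D.P₁ (D.U₁.toEuclideanLin x + D.u₁)

/-- The nonsmooth second-stage term `r₂ i y = P₂ i (U₂ i y + u₂ i)`. -/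
def r₂ (i : Fin K) (y : Vec m₂) : ℝ := D.P₂ i ((D.U₂ i).toEuclideanLin y + D.u₂ i)

/-- The feasible set `X` of the first stage. -/
def X : Set (Vec m₁) :=
  {x | D.A.toEuclideanLin x = D.a ∧ D.B.toEuclideanLin x - D.b ∈ -(D.C₁ : Set (Vec s₁))}

/-- The feasible set `Y (x, ξ i)` of the second stage. -/
def Y (x : Vec m₁) (i : Fin K) : Set (Vec m₂) :=
  {y | (D.A₁ i).toEuclideanLin y + (D.A₂ i).toEuclideanLin x = D.d i ∧
    (D.W i).toEuclideanLin y + (D.T i).toEuclideanLin x - D.h i ∈ -(D.C₂ i : Set (Vec s₂))}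

/-- The joint feasible set `Φ`. -/
def Φ : Set (Primal K m₁ m₂) := {z | z.fst ∈ D.X ∧ ∀ i, z.snd i ∈ D.Y z.fst i}

/-- The optimal value `ϑ (x, ξ i)` of the second-stage problem (`⊤` if it is infeasible). -/
def recourse (x : Vec m₁) (i : Fin K) : EReal :=
  ⨅ y ∈ D.Y x i, ((D.q i y + D.r₂ i y : ℝ) : EReal)

/-- The smooth part of the objective. -/
def fHat (z : Primal K m₁ m₂) : ℝ := D.c z.fst + ∑ i, D.p i * D.q i (z.snd i)

/-- The nonsmooth part of the objective. -/
def Ψ (z : Primal K m₁ m₂) : ℝ := D.r₁ z.fst + ∑ i, D.p i * D.r₂ i (z.snd i)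

/-- The inner mapping `𝒰`. -/
def 𝒰 (z : Primal K m₁ m₂) : Inner l₁ l₂ :=
  WithLp.toLp 2 (D.U₁.toEuclideanLin z.fst + D.u₁,
    WithLp.toLp 2 fun i => (D.U₂ i).toEuclideanLin (z.snd i) + D.u₂ i)

/-- The outer function `P`, so that `Ψ = P ∘ 𝒰`. -/
def P (w : Inner l₁ l₂) : ℝ := D.P₁ w.fst + ∑ i, D.p i * D.P₂ i (w.snd i)

/-- The constraint mapping `G`. -/
def G (z : Primal K m₁ m₂) : Dual K n₁ n₂ s₁ s₂ :=
  WithLp.toLp 2 (D.A.toEuclideanLin z.fst - D.a,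
    WithLp.toLp 2 (D.B.toEuclideanLin z.fst - D.b,
      WithLp.toLp 2
        (WithLp.toLp 2 fun i =>
          (D.A₁ i).toEuclideanLin (z.snd i) + (D.A₂ i).toEuclideanLin z.fst - D.d i,
        WithLp.toLp 2 fun i =>
          (D.W i).toEuclideanLin (z.snd i) + (D.T i).toEuclideanLin z.fst - D.h i)))

/-- The convex cone `𝒦 = {0} × -C₁ × {0}^K × ∏ i, -(C₂ i)`. -/
def 𝒦 : Set (Dual K n₁ n₂ s₁ s₂) :=
  {w | w.fst = 0 ∧ w.snd.fst ∈ -(D.C₁ : Set (Vec s₁)) ∧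
    (∀ i, w.snd.snd.fst i = 0) ∧ ∀ i, w.snd.snd.snd i ∈ -(D.C₂ i : Set (Vec s₂))}

theorem Ψ_eq_P_𝒰 (z : Primal K m₁ m₂) : D.Ψ z = D.P (D.𝒰 z) := rfl

theorem mem_Φ_iff (z : Primal K m₁ m₂) : z ∈ D.Φ ↔ D.G z ∈ D.𝒦 := by
  simp only [Φ, X, Y, G, 𝒦, Set.mem_ofPred_eq, WithLp.toLp_fst, WithLp.toLp_snd, sub_eq_zero,
    forall_and, and_assoc]

/-- The standing assumptions on the program. -/
structure StandingAssumptions : Prop where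
  /-- `p` is a probability vector. -/
  p_nonneg : ∀ i, 0 ≤ D.p i
  p_sum : ∑ i, D.p i = 1
  /-- The cones have nonempty interior. -/
  C₁_interior : (interior (D.C₁ : Set (Vec s₁))).Nonempty
  C₂_interior : ∀ i, (interior (D.C₂ i : Set (Vec s₂))).Nonempty
  /-- The outer nonsmooth functions are lower semicontinuous and bounded from below. -/
  P₁_lsc : LowerSemicontinuous D.P₁
  P₁_bdd : BddBelow (Set.range D.P₁)
  P₂_lsc : ∀ i, LowerSemicontinuous (D.P₂ i)
  P₂_bdd : ∀ i, BddBelow (Set.range (D.P₂ i))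
  /-- The smooth functions are convex and twice continuously differentiable. -/
  c_smooth : ContDiff ℝ 2 D.c
  c_convex : ConvexOn ℝ Set.univ D.c
  q_smooth : ∀ i, ContDiff ℝ 2 (D.q i)
  q_convex : ∀ i, ConvexOn ℝ Set.univ (D.q i)
  /-- The joint feasible set is compact. -/
  compact : IsCompact D.Φ
  /-- The expected absolute recourse is finite. -/
  recourse_finite : ∀ x ∈ D.X, ∑ i, ENNReal.ofReal (D.p i) * (D.recourse x i).abs < ⊤
  /-- There is a Slater point. -/
  slater : ∃ (x : Vec m₁) (y : Fin K → Vec m₂),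
    D.A.toEuclideanLin x = D.a ∧
    (∀ i, (D.A₁ i).toEuclideanLin (y i) + (D.A₂ i).toEuclideanLin x = D.d i) ∧
    D.B.toEuclideanLin x - D.b ∈ interior (-(D.C₁ : Set (Vec s₁))) ∧
    ∀ i, (D.W i).toEuclideanLin (y i) + (D.T i).toEuclideanLin x - D.h i ∈
      interior (-(D.C₂ i : Set (Vec s₂)))

/-- `z` is a local optimal solution of: minimize `fHat + Ψ` subject to `G z ∈ 𝒦`. -/
def IsLocalSolution (z : Primal K m₁ m₂) : Prop :=
  D.G z ∈ D.𝒦 ∧ IsLocalMinOn (fun w => D.fHat w + D.Ψ w) {w | D.G w ∈ D.𝒦} z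

/-- The basic qualification at `z`. -/
def BasicQualification (z : Primal K m₁ m₂) : Prop :=
  -horizonSubdiff D.Ψ z ∩ limitingNormalCone D.Φ z = {0}

/-- The horizon qualification at `z`. -/
def HorizonQualification (z : Primal K m₁ m₂) : Prop :=
  ∀ μ ∈ horizonSubdiff D.P (D.𝒰 z), gradMap D.𝒰 z μ = 0 → μ = 0

/-- `z` is a KKT point. -/
def IsKKTPoint (z : Primal K m₁ m₂) : Prop :=
  z ∈ D.Φ ∧ ∃ μ ∈ limitingSubdiff D.P (D.𝒰 z), ∃ M ∈ limitingNormalCone D.𝒦 (D.G z),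
    0 = gradient D.fHat z + gradMap D.𝒰 z μ + gradMap D.G z M

end Data

end TwoStageSCP

end

namespace TwoStageSCP

/-! ### Subdifferential calculus in finite dimension: penalization, sum rule, chain rule. -/

section Calculus

/-! Nonsmooth terms are decoupled by penalization. For a strict local minimizer of `g + P ∘ L` on
`S`, let `w` be independent of `L z` and charge `t * ‖w - L z‖ ^ 2`. Minimality in `w` and in `z`
then yields one vector `μ`, a Fréchet subgradient of `P` at `w` whose pullback balances `g` on `S`
(`exists_approx_multiplier`). As the points converge, either the `μ` have a convergent subsequence,
giving a limiting subgradient, or normalizing them gives a nonzero horizon subgradient, which a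
qualification excludes (`exists_limiting_or_horizon`).

With `L = id` this gives `v ∈ ∂Ψ` with `-∇fHat - v` normal to `Φ`, by (A6); with `L = 𝒰` it gives `v
= ∇𝒰 μ` with `μ ∈ ∂P`, by (A7). Finally `Φ` is convex, so a normal vector is a linear function
maximized over `Φ` at the base point. Separation and the Slater point turn it into `∇G M` with `M`
normal to `𝒦` (`exists_lagrange_multiplier`). -/

theorem tendsto_of_dist_lt_one_div {X : Type*} [PseudoMetricSpace X] {a b : ℕ → X} {x : X}
    (hb : Tendsto b atTop (𝓝 x)) (hab : ∀ n : ℕ, dist (a n) (b n) < 1 / ((n : ℝ) + 1)) :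
    Tendsto a atTop (𝓝 x) :=
  (tendsto_iff_of_dist (squeeze_zero (fun _ => dist_nonneg) (fun n => (hab n).le)
    tendsto_one_div_add_atTop_nhds_zero_nat)).2 hb

theorem eventually_sq_le {E : Type*} [NormedAddCommGroup E] (w : E) (c : ℝ) {ε : ℝ} (hε : 0 < ε) :
    ∀ᶠ w' in 𝓝 w, c * ‖w' - w‖ ^ 2 ≤ ε * ‖w' - w‖ := by
  have h : Tendsto (fun w' : E => c * ‖w' - w‖) (𝓝 w) (𝓝 0) := by
    have : Continuous fun w' : E => c * ‖w' - w‖ := by fun_prop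
    simpa using this.tendsto w
  filter_upwards [h.eventually (gt_mem_nhds hε)] with w' hw'
  nlinarith [norm_nonneg (w' - w)]

variable {E F : Type*} [NormedAddCommGroup E] [InnerProductSpace ℝ E]
  [NormedAddCommGroup F] [InnerProductSpace ℝ F]

/-- Quadratic penalization of the equation `w = L z` at a strict local minimizer of
`g + P ∘ L` on `S`. -/
theorem exists_penalized_min [FiniteDimensional ℝ E] [FiniteDimensional ℝ F]
    {S : Set E} (hS : IsClosed S) {L : E → F} (hL : Continuous L) {g : E → ℝ} (hg : Continuous g)
    {P : F → ℝ} (hP : LowerSemicontinuous P) {z₀ : E} (hz₀ : z₀ ∈ S) {r : ℝ} (hr : 0 < r)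
    (hmin : ∀ z ∈ S, z ≠ z₀ → dist z z₀ ≤ r → g z₀ + P (L z₀) < g z + P (L z))
    {δ : ℝ} (hδ : 0 < δ) :
    ∃ t : ℝ, 0 < t ∧ ∃ z ∈ S, ∃ w, dist z z₀ < δ ∧ dist w (L z₀) < δ ∧ |P w - P (L z₀)| < δ ∧
      (∀ᶠ z' in 𝓝[S] z, g z + t * ‖w - L z‖ ^ 2 ≤ g z' + t * ‖w - L z'‖ ^ 2) ∧
      ∀ᶠ w' in 𝓝 w, P w + t * ‖w - L z‖ ^ 2 ≤ P w' + t * ‖w' - L z‖ ^ 2 := by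
  have := FiniteDimensional.proper ℝ E
  have := FiniteDimensional.proper ℝ F
  set Q : Set (E × F) := (S ∩ Metric.closedBall z₀ r) ×ˢ Metric.closedBall (L z₀) 1 with hQ
  have hQc : IsCompact Q :=
    ((isCompact_closedBall z₀ r).inter_left hS).prod (isCompact_closedBall _ _)
  have h₀Q : (z₀, L z₀) ∈ Q := by
    simp [hQ, hz₀, hr.le]
  have hlsc : LowerSemicontinuous fun x : E × F => g x.1 + P x.2 :=
    (hg.comp continuous_fst).lowerSemicontinuous.add (hP.comp continuous_snd)
  have hpen : ∀ n : ℕ, ∃ x ∈ Q, IsMinOn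
      (fun x : E × F => (g x.1 + P x.2) + n * ‖x.2 - L x.1‖ ^ 2) Q x := fun n => by
    have hc : Continuous fun x : E × F => (n : ℝ) * ‖x.2 - L x.1‖ ^ 2 := by fun_prop
    exact LowerSemicontinuousOn.exists_isMinOn ⟨_, h₀Q⟩ hQc
      ((hlsc.add hc.lowerSemicontinuous).lowerSemicontinuousOn _)
  choose x hxQ hx using hpen
  -- A lower bound for the unpenalized objective on `Q` forces the squared gap to be `O(1/n)`.
  obtain ⟨b, -, hb⟩ := LowerSemicontinuousOn.exists_isMinOn ⟨_, h₀Q⟩ hQc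
    (hlsc.lowerSemicontinuousOn _)
  have hle : ∀ n, g (x n).1 + P (x n).2 + n * ‖(x n).2 - L (x n).1‖ ^ 2 ≤ g z₀ + P (L z₀) := by
    intro n
    simpa using hx n h₀Q
  obtain ⟨y, hyQ, φ, hφ, hlim⟩ := hQc.tendsto_subseq hxQ
  have hφt : Tendsto (fun n => ((φ n : ℕ) : ℝ)) atTop atTop :=
    tendsto_natCast_atTop_atTop.comp hφ.tendsto_atTop
  have hsq : Tendsto (fun n => ‖(x (φ n)).2 - L (x (φ n)).1‖ ^ 2) atTop (𝓝 0) := by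
    have h1 : Tendsto (fun n => (g z₀ + P (L z₀) - (g b.1 + P b.2)) / (φ n : ℝ)) atTop (𝓝 0) :=
      tendsto_const_nhds.div_atTop hφt
    refine tendsto_of_tendsto_of_tendsto_of_le_of_le' tendsto_const_nhds h1
      (.of_forall fun n => by positivity) ?_
    filter_upwards [hφt.eventually_gt_atTop 0] with n hn
    rw [le_div_iff₀ hn]
    have h2 := hle (φ n)
    have h3 : g b.1 + P b.2 ≤ g (x (φ n)).1 + P (x (φ n)).2 := hb (hxQ (φ n))
    linarith
  have hyL : y.2 = L y.1 := by
    have h1 : Tendsto (fun n => ‖(x (φ n)).2 - L (x (φ n)).1‖ ^ 2) atTop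
        (𝓝 (‖y.2 - L y.1‖ ^ 2)) :=
      ((by fun_prop : Continuous fun x : E × F => ‖x.2 - L x.1‖ ^ 2).tendsto y).comp hlim
    have h2 := tendsto_nhds_unique h1 hsq
    exact sub_eq_zero.1 (norm_eq_zero.1 (pow_eq_zero_iff two_ne_zero |>.1 h2))
  -- At another limit point, strict minimality and lower semicontinuity would push the objective
  -- above the bound `hle`.
  have hy1 : y.1 = z₀ := by
    by_contra hne
    have h1 := hmin y.1 hyQ.1.1 hne hyQ.1.2
    rw [← hyL] at h1
    obtain ⟨n, hn⟩ := (hlim.eventually (hlsc y _ h1)).exists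
    have h2 := hle (φ n)
    have h3 : 0 ≤ (φ n : ℝ) * ‖(x (φ n)).2 - L (x (φ n)).1‖ ^ 2 := by positivity
    simp only [Function.comp] at hn
    linarith
  have hy : y = (z₀, L z₀) := Prod.ext hy1 (by rw [hyL, hy1])
  subst hy
  have hl1 : Tendsto (fun n => (x (φ n)).1) atTop (𝓝 z₀) := (continuous_fst.tendsto _).comp hlim
  have hl2 : Tendsto (fun n => (x (φ n)).2) atTop (𝓝 (L z₀)) :=
    (continuous_snd.tendsto _).comp hlim
  have hg1 : Tendsto (fun n => g (x (φ n)).1) atTop (𝓝 (g z₀)) := (hg.tendsto _).comp hl1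
  obtain ⟨n, hn0, hnz, hnw, hnP, hng⟩ := ((hφt.eventually_gt_atTop 0).and
    ((hl1.eventually (Metric.ball_mem_nhds _ (lt_min hδ hr))).and
    ((hl2.eventually (Metric.ball_mem_nhds _ (lt_min hδ one_pos))).and
    ((hl2.eventually (hP _ _ (sub_lt_self _ hδ))).and
    (hg1.eventually (lt_mem_nhds (sub_lt_self _ hδ))))))).exists
  have hnz' : dist (x (φ n)).1 z₀ < min δ r := hnz
  have hnw' : dist (x (φ n)).2 (L z₀) < min δ 1 := hnw
  rw [lt_min_iff] at hnz' hnw'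
  have hpos : 0 ≤ (φ n : ℝ) * ‖(x (φ n)).2 - L (x (φ n)).1‖ ^ 2 := by positivity
  refine ⟨φ n, hn0, (x (φ n)).1, (hxQ _).1.1, (x (φ n)).2, hnz'.1, hnw'.1, ?_, ?_, ?_⟩
  -- Semicontinuity bounds `P w` only from below; the upper bound comes from `hle` and the
  -- convergence of `g`.
  · have h2 := hle (φ n)
    rw [abs_lt]
    constructor <;> linarith
  · filter_upwards [self_mem_nhdsWithin,
      mem_nhdsWithin_of_mem_nhds (Metric.isOpen_ball.mem_nhds hnz'.2)] with z' h1 h2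
    have h3 := hx (φ n) (show (z', (x (φ n)).2) ∈ Q from
      ⟨⟨h1, Metric.ball_subset_closedBall h2⟩, (hxQ _).2⟩)
    simp only [Set.mem_ofPred_eq] at h3
    linarith
  · filter_upwards [Metric.isOpen_ball.mem_nhds hnw'.2] with w' h2
    have h3 := hx (φ n) (show ((x (φ n)).1, w') ∈ Q from
      ⟨(hxQ _).1, Metric.ball_subset_closedBall h2⟩)
    simp only [Set.mem_ofPred_eq] at h3
    linarith

/-- The approximate multiplier rule for a strict local minimizer of `g + P ∘ L` on `S`, where
`L` is affine. -/
theorem exists_approx_multiplier [FiniteDimensional ℝ E] [FiniteDimensional ℝ F]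
    {S : Set E} (hS : IsClosed S) {L : E → F} (L₀ : E →L[ℝ] F)
    (hL : ∀ z z', L z' - L z = L₀ (z' - z)) {g : E → ℝ} (hg : Continuous g)
    {P : F → ℝ} (hP : LowerSemicontinuous P) {z₀ : E} (hz₀ : z₀ ∈ S) {r : ℝ} (hr : 0 < r)
    (hmin : ∀ z ∈ S, z ≠ z₀ → dist z z₀ ≤ r → g z₀ + P (L z₀) < g z + P (L z))
    {δ : ℝ} (hδ : 0 < δ) :
    ∃ z ∈ S, ∃ w, ∃ μ ∈ frechetSubdiff P w,
      dist z z₀ < δ ∧ dist w (L z₀) < δ ∧ dist (P w) (P (L z₀)) < δ ∧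
      ∀ ε : ℝ, 0 < ε → ∀ᶠ z' in 𝓝[S] z,
        -(ε * ‖z' - z‖) ≤ g z' - g z + inner ℝ μ (L₀ (z' - z)) := by
  have hLc : Continuous L := by
    have : L = fun z => L₀ z + L 0 := by
      funext z
      rw [← sub_eq_iff_eq_add, hL, sub_zero]
    rw [this]
    fun_prop
  obtain ⟨t, ht, z, hz, w, h1, h2, h3, h4, h5⟩ :=
    exists_penalized_min hS hLc hg hP hz₀ hr hmin hδ
  -- Minus the gradient of the penalty in `w`; its image under the adjoint of `L₀` is the gradient
  -- of the penalty in `z`.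
  refine ⟨z, hz, w, (2 * t) • (L z - w), ?_, h1, h2, by rwa [Real.dist_eq], ?_⟩
  · intro ε hε
    filter_upwards [h5, eventually_sq_le w t hε] with w' h6 h7
    have h8 : ‖w' - L z‖ ^ 2 = ‖w - L z‖ ^ 2 - 2 * inner ℝ (L z - w) (w' - w)
        + ‖w' - w‖ ^ 2 := by
      rw [norm_sub_rev w (L z), ← norm_sub_sq_real, norm_sub_rev]
      congr 2
      abel
    rw [real_inner_smul_left]
    rw [h8] at h6
    nlinarith
  · intro ε hε
    filter_upwards [h4, mem_nhdsWithin_of_mem_nhds (eventually_sq_le z (t * ‖L₀‖ ^ 2) hε)]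
      with z' h6 h7
    have h8 : ‖w - L z'‖ ^ 2 = ‖w - L z‖ ^ 2 + 2 * inner ℝ (L z - w) (L₀ (z' - z))
        + ‖L₀ (z' - z)‖ ^ 2 := by
      rw [norm_sub_rev w (L z), ← norm_add_sq_real, norm_sub_rev, ← hL]
      congr 2
      abel
    have h9 : ‖L₀ (z' - z)‖ ^ 2 ≤ ‖L₀‖ ^ 2 * ‖z' - z‖ ^ 2 := by
      rw [← mul_pow]
      exact pow_le_pow_left₀ (norm_nonneg _) (L₀.le_opNorm _) 2
    rw [real_inner_smul_left]
    rw [h8] at h6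
    have h10 := mul_le_mul_of_nonneg_left h9 ht.le
    linarith

/-- Fréchet subgradients along an `f`-attentive sequence have, up to a subsequence, a limiting
subgradient as limit, or, after normalization, a horizon subgradient of norm one. -/
theorem exists_limiting_or_horizon [FiniteDimensional ℝ E] {f : E → ℝ} {w : E} {ws vs : ℕ → E}
    (hw : Tendsto ws atTop (𝓝 w)) (hf : Tendsto (fun k => f (ws k)) atTop (𝓝 (f w)))
    (hv : ∀ k, vs k ∈ frechetSubdiff f (ws k)) :
    (∃ v ∈ limitingSubdiff f w, ∃ φ : ℕ → ℕ, StrictMono φ ∧ Tendsto (vs ∘ φ) atTop (𝓝 v)) ∨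
    ∃ v ∈ horizonSubdiff f w, v ≠ 0 ∧ ∃ (φ : ℕ → ℕ) (α : ℕ → ℝ), StrictMono φ ∧
      (∀ k, 0 < α k) ∧ Tendsto α atTop (𝓝 0) ∧
      Tendsto (fun k => α k • vs (φ k)) atTop (𝓝 v) := by
  have := FiniteDimensional.proper ℝ E
  by_cases hb : ∃ R : ℝ, ∃ᶠ k in atTop, ‖vs k‖ ≤ R
  · obtain ⟨R, hR⟩ := hb
    obtain ⟨v, -, φ, hφ, hlim⟩ := (isCompact_closedBall (0 : E) R).tendsto_subseq' (x := vs)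
      (hR.mono fun k hk => by simpa using hk)
    exact .inl ⟨v, ⟨ws ∘ φ, vs ∘ φ, hw.comp hφ.tendsto_atTop, hf.comp hφ.tendsto_atTop,
      fun k => hv _, hlim⟩, φ, hφ, hlim⟩
  · right
    push Not at hb
    have hinf : Tendsto (fun k => ‖vs k‖) atTop atTop :=
      tendsto_atTop.2 fun R => (hb R).mono fun k hk => hk.le
    -- Shifting by `N` drops the possibly zero vectors, so every normalizing factor is positive.
    obtain ⟨N, hN⟩ := eventually_atTop.1 (hinf.eventually_gt_atTop 0)
    obtain ⟨v, hv1, φ, hφ, hlim⟩ := (isCompact_sphere (0 : E) 1).tendsto_subseq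
      (x := fun k => ‖vs (k + N)‖⁻¹ • vs (k + N)) (fun k => by
        have := hN (k + N) (by omega)
        simp [norm_smul, this.ne'])
    have hψ : StrictMono fun k => φ k + N := fun a b hab => by
      have := hφ hab
      dsimp only
      omega
    have hα : ∀ k, 0 < ‖vs (φ k + N)‖⁻¹ := fun k => inv_pos.2 (hN _ (by omega))
    have hα0 : Tendsto (fun k => ‖vs (φ k + N)‖⁻¹) atTop (𝓝 0) :=
      tendsto_inv_atTop_zero.comp (hinf.comp hψ.tendsto_atTop)
    refine ⟨v, ⟨fun k => ws (φ k + N), fun k => vs (φ k + N), _, hw.comp hψ.tendsto_atTop,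
      hf.comp hψ.tendsto_atTop, hα, hα0, fun k => hv _, hlim⟩, ?_, _, _, hψ, hα, hα0, hlim⟩
    rintro rfl
    simp at hv1

theorem smul_mem_frechetNormalCone {S : Set E} {w v : E} (hv : v ∈ frechetNormalCone S w)
    {t : ℝ} (ht : 0 < t) : t • v ∈ frechetNormalCone S w := by
  refine ⟨hv.1, fun ε hε => ?_⟩
  filter_upwards [hv.2 (ε / t) (div_pos hε ht)] with w' h
  rw [real_inner_smul_left]
  calc t * inner ℝ v (w' - w) ≤ t * (ε / t * ‖w' - w‖) := mul_le_mul_of_nonneg_left h ht.le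
    _ = ε * ‖w' - w‖ := by field_simp

/-- The sum rule at a local minimizer of `g + f` on `S`. -/
theorem exists_subgradient_of_isLocalMinOn [FiniteDimensional ℝ E] {S : Set E} (hS : IsClosed S)
    {g f : E → ℝ} (hg : ContDiff ℝ 1 g) (hf : LowerSemicontinuous f) {z₀ : E} (hz₀ : z₀ ∈ S)
    (hmin : IsLocalMinOn (fun z => g z + f z) S z₀)
    (hq : -horizonSubdiff f z₀ ∩ limitingNormalCone S z₀ ⊆ {0}) :
    ∃ v ∈ limitingSubdiff f z₀, -gradient g z₀ - v ∈ limitingNormalCone S z₀ := by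
  obtain ⟨r, hr, hball⟩ := Metric.mem_nhdsWithin_iff.1 hmin
  -- The square makes the local minimizer strict, and its gradient vanishes at `z₀`, so the limit is
  -- unaffected.
  set g' : E → ℝ := fun z => g z + ‖z - z₀‖ ^ 2 with hg'
  have hgrad : ∀ z, HasGradientAt g (gradient g z) z := fun z =>
    (hg.differentiable one_ne_zero z).hasGradientAt
  have hgc : Continuous (gradient g) :=
    (InnerProductSpace.toDual ℝ E).symm.continuous.comp (hg.continuous_fderiv one_ne_zero)
  have happ : ∀ n : ℕ, ∃ z ∈ S, ∃ w, ∃ μ ∈ frechetSubdiff f w,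
      dist z z₀ < 1 / ((n : ℝ) + 1) ∧ dist w z₀ < 1 / ((n : ℝ) + 1) ∧
      dist (f w) (f z₀) < 1 / ((n : ℝ) + 1) ∧
      ∀ ε : ℝ, 0 < ε → ∀ᶠ z' in 𝓝[S] z,
        -(ε * ‖z' - z‖) ≤ g' z' - g' z + inner ℝ μ (z' - z) := by
    intro n
    refine exists_approx_multiplier (L := id) hS (.id ℝ E) (fun _ _ => rfl)
      (by have := hg.continuous; fun_prop) hf hz₀ (half_pos hr) (fun z hz hne hd => ?_)
      Nat.one_div_pos_of_nat
    have h1 : g z₀ + f z₀ ≤ g z + f z :=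
      hball ⟨Metric.mem_ball.2 (hd.trans_lt (half_lt_self hr)), hz⟩
    have h2 : 0 < ‖z - z₀‖ ^ 2 := by
      have := norm_pos_iff.2 (sub_ne_zero.2 hne)
      positivity
    simp only [hg', id, sub_self, norm_zero]
    linarith
  choose z hzS w μ hμ hdz hdw hdf hz using happ
  have hz_lim : Tendsto z atTop (𝓝 z₀) :=
    tendsto_of_dist_lt_one_div tendsto_const_nhds hdz
  have hw_lim : Tendsto w atTop (𝓝 z₀) :=
    tendsto_of_dist_lt_one_div tendsto_const_nhds hdw
  have hf_lim : Tendsto (fun n => f (w n)) atTop (𝓝 (f z₀)) :=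
    tendsto_of_dist_lt_one_div tendsto_const_nhds hdf
  set η : ℕ → E := fun n => gradient g (z n) + (2 : ℝ) • (z n - z₀) with hη
  have hη_lim : Tendsto η atTop (𝓝 (gradient g z₀)) := by
    have h : Continuous fun x => gradient g x + (2 : ℝ) • (x - z₀) := by fun_prop
    simpa [hη, Function.comp_def] using (h.tendsto z₀).comp hz_lim
  have hnormal : ∀ n, -η n - μ n ∈ frechetNormalCone S (z n) := by
    intro n
    refine ⟨hzS n, fun ε hε => ?_⟩
    have h1 := (hasGradientAt_iff_isLittleO.1 (hgrad (z n))).def (c := ε / 3) (by positivity)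
    filter_upwards [hz n (ε / 3) (by positivity), mem_nhdsWithin_of_mem_nhds h1,
      mem_nhdsWithin_of_mem_nhds (eventually_sq_le (z n) 1 (ε := ε / 3) (by positivity))]
      with z' h2 h3 h4
    have h5 : ‖z' - z₀‖ ^ 2 = ‖z n - z₀‖ ^ 2 + 2 * inner ℝ (z n - z₀) (z' - z n)
        + ‖z' - z n‖ ^ 2 := by
      rw [← norm_add_sq_real]
      congr 2
      abel
    have h6 := (abs_le.1 (Real.norm_eq_abs _ ▸ h3)).2
    simp only [hη, hg', inner_sub_left, inner_neg_left, inner_add_left, real_inner_smul_left]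
      at h2 h5 h6 ⊢
    linarith
  rcases exists_limiting_or_horizon hw_lim hf_lim hμ with
    ⟨v, hv, φ, hφ, hlim⟩ | ⟨v, hv, hv0, φ, α, hφ, hα, hα0, hlim⟩
  · exact ⟨v, hv, hz₀, z ∘ φ, fun k => -η (φ k) - μ (φ k), hz_lim.comp hφ.tendsto_atTop,
      fun k => hnormal _, ((hη_lim.comp hφ.tendsto_atTop).neg).sub hlim⟩
  -- Scaling by `α` sends the convergent `η` to zero, so `-v` is normal to `S`, against the
  -- qualification.
  · refine absurd (neg_eq_zero.1 (hq ⟨by simpa using hv, hz₀, z ∘ φ,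
      fun k => α k • (-η (φ k) - μ (φ k)), hz_lim.comp hφ.tendsto_atTop,
      fun k => smul_mem_frechetNormalCone (hnormal _) (hα k), ?_⟩)) hv0
    have := (hα0.smul (hη_lim.comp hφ.tendsto_atTop).neg).sub hlim
    simpa [smul_sub] using this

/-- The approximate chain rule for Fréchet subgradients of `P ∘ L` with `L` affine. -/
theorem exists_approx_chain [FiniteDimensional ℝ E] [FiniteDimensional ℝ F]
    {L : E → F} (L₀ : E →L[ℝ] F) (hL : ∀ z z', L z' - L z = L₀ (z' - z))
    {P : F → ℝ} (hP : LowerSemicontinuous P) {z₀ v : E}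
    (hv : v ∈ frechetSubdiff (fun z => P (L z)) z₀) {δ : ℝ} (hδ : 0 < δ) :
    ∃ w, ∃ μ ∈ frechetSubdiff P w, dist w (L z₀) < δ ∧ dist (P w) (P (L z₀)) < δ ∧
      dist (ContinuousLinearMap.adjoint L₀ μ) v < δ := by
  -- The error `δ / 6` lies below the slope `δ / 3` in `g`, so `z₀` is a strict local minimizer of
  -- `g + P ∘ L`.
  obtain ⟨r, hr, hball⟩ := Metric.eventually_nhds_iff.1 (hv (δ / 6) (by positivity))
  set g : E → ℝ := fun z => δ / 3 * ‖z - z₀‖ - inner ℝ v (z - z₀) with hg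
  obtain ⟨z, -, w, μ, hμ, -, h2, h3, h4⟩ := exists_approx_multiplier (g := g) isClosed_univ L₀ hL
    (by fun_prop) hP (Set.mem_univ z₀) (half_pos hr) (fun z _ hne hd => by
      have h1 := hball (hd.trans_lt (half_lt_self hr))
      have h2 := norm_pos_iff.2 (sub_ne_zero.2 hne)
      have h3 : 0 < δ * ‖z - z₀‖ := by positivity
      simp only [hg, sub_self, norm_zero, inner_zero_right]
      linarith) hδ
  refine ⟨w, μ, hμ, h2, h3, ?_⟩
  set d : E := ContinuousLinearMap.adjoint L₀ μ - v with hd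
  rw [dist_eq_norm, ← hd]
  -- A small move along `-d` gives `‖d‖ ^ 2 ≤ (δ / 3 + δ / 3) * ‖d‖`: one third from the norm in
  -- `g`, one from the tolerance.
  have h5 := h4 (δ / 3) (by positivity)
  rw [nhdsWithin_univ] at h5
  have hcurve : Tendsto (fun t : ℝ => z - t • d) (𝓝[>] 0) (𝓝 z) := by
    have : Continuous fun t : ℝ => z - t • d := by fun_prop
    exact tendsto_nhdsWithin_of_tendsto_nhds (by simpa using this.tendsto 0)
  obtain ⟨t, ht, ht0⟩ := ((hcurve.eventually h5).and self_mem_nhdsWithin).exists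
  have ht0 : 0 < t := ht0
  have h6 : ‖z - t • d - z₀‖ ≤ ‖z - z₀‖ + t * ‖d‖ := by
    rw [show z - t • d - z₀ = (z - z₀) - t • d by abel]
    refine (norm_sub_le _ _).trans_eq ?_
    rw [norm_smul, Real.norm_of_nonneg ht0.le]
  have h7 : z - t • d - z₀ = (z - z₀) - t • d := by abel
  have h8 : inner ℝ μ (L₀ d) = inner ℝ v d + ‖d‖ ^ 2 := by
    rw [← ContinuousLinearMap.adjoint_inner_left, ← real_inner_self_eq_norm_sq,
      ← inner_add_left, hd]
    congr 1
    abel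
  have h9 : z - t • d - z = -(t • d) := by abel
  simp only [hg, h9] at ht
  rw [norm_neg, norm_smul, Real.norm_of_nonneg ht0.le, map_neg, map_smul, inner_neg_right,
    real_inner_smul_right, h8, h7, inner_sub_right v (z - z₀), real_inner_smul_right, ← h7] at ht
  by_contra hcon
  push Not at hcon
  have h10 := mul_le_mul_of_nonneg_left h6 (by positivity : (0 : ℝ) ≤ δ / 3)
  have h11 : t * ‖d‖ * ‖d‖ ≤ 2 * (δ / 3) * (t * ‖d‖) := by nlinarith
  have h12 : 0 < t * ‖d‖ := mul_pos ht0 (hδ.trans_le hcon)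
  nlinarith

/-- The chain rule for limiting subgradients of `P ∘ L` with `L` affine. -/
theorem exists_of_mem_limitingSubdiff_comp [FiniteDimensional ℝ E] [FiniteDimensional ℝ F]
    {L : E → F} (L₀ : E →L[ℝ] F) (hL : ∀ z z', L z' - L z = L₀ (z' - z))
    {P : F → ℝ} (hP : LowerSemicontinuous P) {z₀ v : E}
    (hq : ∀ μ ∈ horizonSubdiff P (L z₀), ContinuousLinearMap.adjoint L₀ μ = 0 → μ = 0)
    (hv : v ∈ limitingSubdiff (fun z => P (L z)) z₀) :
    ∃ μ ∈ limitingSubdiff P (L z₀), ContinuousLinearMap.adjoint L₀ μ = v := by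
  obtain ⟨zs, vs, hzs, hfs, hvs, hlim⟩ := hv
  choose w μ hμ hdw hdP hdv using fun n : ℕ =>
    exists_approx_chain L₀ hL hP (hvs n) (Nat.one_div_pos_of_nat (α := ℝ) (n := n))
  have hLc : Continuous L := by
    have : L = fun z => L₀ z + L 0 := by
      funext z
      rw [← sub_eq_iff_eq_add, hL, sub_zero]
    rw [this]
    fun_prop
  have hw_lim : Tendsto w atTop (𝓝 (L z₀)) :=
    tendsto_of_dist_lt_one_div ((hLc.tendsto z₀).comp hzs) hdw
  have hP_lim : Tendsto (fun n => P (w n)) atTop (𝓝 (P (L z₀))) :=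
    tendsto_of_dist_lt_one_div hfs hdP
  have hv_lim : Tendsto (fun n => ContinuousLinearMap.adjoint L₀ (μ n)) atTop (𝓝 v) :=
    tendsto_of_dist_lt_one_div hlim hdv
  have hadj := (ContinuousLinearMap.adjoint L₀).continuous
  rcases exists_limiting_or_horizon hw_lim hP_lim hμ with
    ⟨u, hu, φ, hφ, hlim'⟩ | ⟨u, hu, hu0, φ, α, hφ, hα, hα0, hlim'⟩
  · exact ⟨u, hu, tendsto_nhds_unique ((hadj.tendsto u).comp hlim')
      (hv_lim.comp hφ.tendsto_atTop)⟩
  -- The pulled-back subgradients converge, so scaling by `α` sends them to zero and `u` lies in the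
  -- kernel of the adjoint.
  · refine absurd (hq u hu (tendsto_nhds_unique ((hadj.tendsto u).comp hlim') ?_)) hu0
    simpa [Function.comp_def] using hα0.smul (hv_lim.comp hφ.tendsto_atTop)

end Calculus

/-! ### Normals to convex sets and Lagrange multipliers. -/

section Convex

variable {E F₁ F₂ : Type*} [NormedAddCommGroup E] [InnerProductSpace ℝ E]
  [NormedAddCommGroup F₁] [InnerProductSpace ℝ F₁] [NormedAddCommGroup F₂] [InnerProductSpace ℝ F₂]

/-- The segment from `w` to `z` stays in `S`; along it a positive product would grow linearly,
violating the bound with half that slope as `ε`. -/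
theorem inner_le_zero_of_mem_frechetNormalCone {S : Set E} (hS : Convex ℝ S) {w v z : E}
    (hv : v ∈ frechetNormalCone S w) (hz : z ∈ S) : inner ℝ v (z - w) ≤ 0 := by
  by_contra! hpos
  have hn : 0 < ‖z - w‖ := norm_pos_iff.2 fun h => by simp [h] at hpos
  have hcurve : Tendsto (fun t : ℝ => w + t • (z - w)) (𝓝[>] 0) (𝓝[S] w) := by
    refine tendsto_nhdsWithin_iff.2 ⟨?_, ?_⟩
    · have : Continuous fun t : ℝ => w + t • (z - w) := by fun_prop
      exact tendsto_nhdsWithin_of_tendsto_nhds (by simpa using this.tendsto 0)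
    · filter_upwards [Ioc_mem_nhdsGT (one_pos : (0 : ℝ) < 1)] with t ht
      exact hS.add_smul_sub_mem hv.1 hz ⟨ht.1.le, ht.2⟩
  obtain ⟨t, ht, ht0⟩ := ((hcurve.eventually (hv.2 (inner ℝ v (z - w) / (2 * ‖z - w‖))
    (by positivity))).and self_mem_nhdsWithin).exists
  have ht0 : 0 < t := ht0
  rw [add_sub_cancel_left, real_inner_smul_right, norm_smul, Real.norm_of_nonneg ht0.le] at ht
  have : inner ℝ v (z - w) / (2 * ‖z - w‖) * (t * ‖z - w‖) = t * inner ℝ v (z - w) / 2 := by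
    field_simp
  nlinarith [mul_pos ht0 hpos]

theorem inner_le_zero_of_mem_limitingNormalCone {S : Set E} (hS : Convex ℝ S) {w v z : E}
    (hv : v ∈ limitingNormalCone S w) (hz : z ∈ S) : inner ℝ v (z - w) ≤ 0 := by
  obtain ⟨-, ws, vs, hws, hvs, hlim⟩ := hv
  exact le_of_tendsto (hlim.inner (tendsto_const_nhds.sub hws))
    (.of_forall fun k => inner_le_zero_of_mem_frechetNormalCone hS (hvs k) hz)

theorem mem_limitingNormalCone_of_inner_le_zero {S : Set E} {w v : E} (hw : w ∈ S)
    (h : ∀ z ∈ S, inner ℝ v (z - w) ≤ 0) : v ∈ limitingNormalCone S w := by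
  refine ⟨hw, fun _ => w, fun _ => v, tendsto_const_nhds, fun _ => ⟨hw, fun ε hε => ?_⟩,
    tendsto_const_nhds⟩
  filter_upwards [self_mem_nhdsWithin] with z hz
  exact (h z hz).trans (by positivity)

/-- Lagrange multipliers for a linear function that is maximal at `z₀` subject to affine
equations and a conic constraint, under the Slater condition. -/
theorem exists_lagrange_multiplier [FiniteDimensional ℝ E] [CompleteSpace F₁]
    [CompleteSpace F₂] (A : E →L[ℝ] F₁) (H : E →L[ℝ] F₂) (h : F₂) (C : ConvexCone ℝ F₂)
    {z₀ z₁ v : E}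
    (hC : (0 : F₂) ∈ C) (h₀ : H z₀ + h ∈ C) (hA : A z₁ = A z₀)
    (h₁ : H z₁ + h ∈ interior (C : Set F₂))
    (hv : ∀ z, A z = A z₀ → H z + h ∈ C → inner ℝ v (z - z₀) ≤ 0) :
    ∃ (η : F₁) (ν : F₂), (∀ x, inner ℝ v x = inner ℝ η (A x) + inner ℝ ν (H x)) ∧
      inner ℝ ν (H z₀ + h) = 0 ∧ ∀ c ∈ C, inner ℝ ν c ≤ 0 := by
  set O : Set F₂ := interior (C : Set F₂) with hO
  have hOconv : Convex ℝ O := C.convex.interior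
  -- The open summand makes `Q` open; `0 ∈ Q` would mean a feasible point with positive objective.
  -- The equations restrict `z` instead of adding a coordinate, and their multiplier is recovered at
  -- the end.
  set Q : Set (ℝ × F₂) := (fun z => (inner ℝ v (z - z₀), H z + h)) '' {z | A z = A z₀} +
    (Set.Iio (0 : ℝ) ×ˢ (-O)) with hQ
  have hQo : IsOpen Q := (isOpen_Iio.prod isOpen_interior.neg).add_left
  have hQc : Convex ℝ Q := by
    refine Convex.add ?_ ((convex_Iio 0).prod hOconv.neg)
    rintro _ ⟨x, hx, rfl⟩ _ ⟨y, hy, rfl⟩ a b - - hab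
    refine ⟨a • x + b • y, ?_, ?_⟩
    · simp only [Set.mem_ofPred_eq] at hx hy ⊢
      rw [map_add, map_smul, map_smul, hx, hy, ← add_smul, hab, one_smul]
    · ext1
      · simp only [Prod.fst_add, Prod.smul_fst, smul_eq_mul, ← real_inner_smul_right,
          ← inner_add_right]
        congr 1
        nth_rw 1 [show z₀ = a • z₀ + b • z₀ by rw [← add_smul, hab, one_smul]]
        module
      · simp only [Prod.snd_add, Prod.smul_snd, map_add, map_smul]
        nth_rw 1 [show h = a • h + b • h by rw [← add_smul, hab, one_smul]]
        module
  have hmem : ∀ z, A z = A z₀ → ∀ s < 0, ∀ c ∈ O, (inner ℝ v (z - z₀) + s, H z + h - c) ∈ Q :=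
    fun z hz s hs c hc => ⟨_, ⟨z, hz, rfl⟩, (s, -c), ⟨hs, by simpa using hc⟩, by
      simp [sub_eq_add_neg]⟩
  have h0Q : (0 : ℝ × F₂) ∉ Q := by
    rintro ⟨_, ⟨z, hz, rfl⟩, ⟨s, c⟩, ⟨hs, hc⟩, heq⟩
    simp only [Prod.mk_add_mk, Prod.mk_eq_zero] at heq
    have h2 : H z + h = -c := eq_neg_of_add_eq_zero_left heq.2
    have h3 := hv z hz (interior_subset (h2 ▸ hc))
    have hs : s < 0 := hs
    linarith [heq.1]
  obtain ⟨f, hf⟩ := geometric_hahn_banach_open_point hQc hQo h0Q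
  set α : ℝ := f (1, 0) with hα
  set m : F₂ := (InnerProductSpace.toDual ℝ F₂).symm (f.comp (.inr ℝ ℝ F₂)) with hm
  have hfm : ∀ s w, f (s, w) = α * s + inner ℝ m w := by
    intro s w
    rw [hm, InnerProductSpace.toDual_symm_apply]
    have : ((s, w) : ℝ × F₂) = s • (1, 0) + (0, w) := by simp
    rw [this, map_add, map_smul, smul_eq_mul, mul_comm]
    rfl
  have hneg : ∀ z, A z = A z₀ → ∀ s < 0, ∀ c ∈ O,
      α * (inner ℝ v (z - z₀) + s) + inner ℝ m (H z + h - c) < 0 := by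
    intro z hz s hs c hc
    have := hf _ (hmem z hz s hs c hc)
    rwa [map_zero, hfm] at this
  have hOsmul : ∀ t : ℝ, 0 < t → ∀ c ∈ O, t • c ∈ O := by
    intro t ht c hc
    have h1 : t • c ∈ t • interior (C : Set F₂) := Set.smul_mem_smul_set hc
    rw [← interior_smul₀ ht.ne'] at h1
    refine interior_mono ?_ h1
    rintro _ ⟨y, hy, rfl⟩
    exact C.smul_mem ht hy
  have hle : ∀ z, A z = A z₀ → ∀ s ≤ 0, ∀ c ∈ C,
      α * (inner ℝ v (z - z₀) + s) + inner ℝ m (H z + h - c) ≤ 0 := by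
    intro z hz s hs c hc
    -- Adding `t • (H z₁ + h)` moves `c` into the interior; letting `t` tend to zero gives the
    -- inequality for all of `C`.
    have hcont : Continuous fun t : ℝ => α * (inner ℝ v (z - z₀) + (s - t)) +
        inner ℝ m (H z + h - (c + t • (H z₁ + h))) := by fun_prop
    have hl := (hcont.tendsto 0).mono_left (nhdsWithin_le_nhds (s := Set.Ioi 0))
    simp only [sub_zero, zero_smul, add_zero] at hl
    refine le_of_tendsto hl ?_
    filter_upwards [self_mem_nhdsWithin] with t ht
    have ht : 0 < t := ht
    refine (hneg z hz (s - t) (by linarith) _ ?_).le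
    have h1 : c + t • (H z₁ + h) ∈ (C : Set F₂) + O := Set.add_mem_add hc (hOsmul t ht _ h₁)
    refine (interior_maximal ?_ isOpen_interior.add_left) h1
    rintro _ ⟨a, ha, b, hb, rfl⟩
    exact C.add_mem ha (interior_subset hb)
  have := FiniteDimensional.complete ℝ E
  -- Taking `c` equal to the conic value cancels `m`. At `z₀` this gives `α ≥ 0`; the strict
  -- inequality at the Slater point excludes `α = 0`.
  have hα0 : 0 < α := by
    have h2 := hle z₀ rfl (-1) (by norm_num) _ h₀
    have h3 := hneg z₁ hA (-1) (by norm_num) _ h₁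
    simp only [sub_self, inner_zero_right] at h2 h3
    refine lt_of_le_of_ne (by linarith) fun h4 => ?_
    simp [← h4] at h3
  have hmC : ∀ c ∈ C, 0 ≤ inner ℝ m c := by
    intro c hc
    have h2 := hle z₀ rfl 0 le_rfl _ (C.add_mem hc h₀)
    simpa using h2
  have hm0 : inner ℝ m (H z₀ + h) = 0 := by
    have h2 := hle z₀ rfl 0 le_rfl 0 hC
    simp only [sub_self, inner_zero_right, add_zero, mul_zero, zero_add, sub_zero] at h2
    exact le_antisymm h2 (hmC _ h₀)
  -- `hle` does not require `z₀ + x` to satisfy the conic constraint, so `x` and `-x` are both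
  -- allowed and equality follows.
  have hker_le : ∀ x, A x = 0 → α * inner ℝ v x + inner ℝ m (H x) ≤ 0 := by
    intro x hx
    have h2 := hle (z₀ + x) (by rw [map_add, hx, add_zero]) 0 le_rfl 0 hC
    rw [add_sub_cancel_left, add_zero, sub_zero, map_add, add_right_comm, inner_add_right, hm0,
      zero_add] at h2
    exact h2
  have hker : ∀ x, A x = 0 → α * inner ℝ v x + inner ℝ m (H x) = 0 := by
    intro x hx
    have h2 := hker_le x hx
    have h3 := hker_le (-x) (by rw [map_neg, hx, neg_zero])
    rw [map_neg, inner_neg_right, inner_neg_right] at h3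
    linarith
  set ν : F₂ := -(α⁻¹ • m) with hν
  have hνx : ∀ w, inner ℝ ν w = -(α⁻¹ * inner ℝ m w) := fun w => by
    rw [hν, inner_neg_left, real_inner_smul_left]
  -- The orthogonal complement of `ker A` is the range of the adjoint, already closed in finite
  -- dimension; this supplies `η`.
  have hperp : v - ContinuousLinearMap.adjoint H ν ∈ A.kerᗮ := by
    rw [Submodule.mem_orthogonal']
    intro x hx
    have h2 := hker x hx
    rw [inner_sub_left, ContinuousLinearMap.adjoint_inner_left, hνx]
    field_simp
    linarith
  rw [ContinuousLinearMap.orthogonal_ker,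
    (Submodule.closed_of_finiteDimensional _).submodule_topologicalClosure_eq] at hperp
  obtain ⟨η, hη⟩ := hperp
  refine ⟨η, ν, fun x => ?_, by rw [hνx, hm0]; simp, fun c hc => ?_⟩
  · rw [← ContinuousLinearMap.adjoint_inner_left A, ← ContinuousLinearMap.adjoint_inner_left H,
      ← inner_add_left]
    congr 1
    exact (eq_add_of_sub_eq hη.symm)
  · rw [hνx]
    have := hmC c hc
    have : 0 ≤ α⁻¹ * inner ℝ m c := by positivity
    linarith

end Convex

/-! ### Application to the two-stage program. -/

@[ext]
theorem Pair.ext {E F : Type} {x y : Pair E F} (h₁ : x.fst = y.fst) (h₂ : x.snd = y.snd) :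
    x = y :=
  WithLp.ofLp_injective 2 (Prod.ext h₁ h₂)

theorem Pair.inner_def {E F : Type} [NormedAddCommGroup E] [InnerProductSpace ℝ E]
    [NormedAddCommGroup F] [InnerProductSpace ℝ F] (x y : Pair E F) :
    inner ℝ x y = inner ℝ x.fst y.fst + inner ℝ x.snd y.snd :=
  WithLp.prod_inner_apply x y

namespace Data

variable {K m₁ m₂ n₁ n₂ s₁ s₂ l₁ : ℕ} {l₂ : Fin K → ℕ}
  (D : Data K m₁ m₂ n₁ n₂ s₁ s₂ l₁ l₂)

/-- The linear part of the inner mapping. -/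
noncomputable def innerLin : Primal K m₁ m₂ →ₗ[ℝ] Inner l₁ l₂ where
  toFun z := WithLp.toLp 2 (D.U₁.toEuclideanLin z.fst,
    WithLp.toLp 2 fun i => (D.U₂ i).toEuclideanLin (z.snd i))
  map_add' x y := by ext <;> simp
  map_smul' t x := by ext <;> simp

/-- The linear part of the equality constraints. -/
noncomputable def eqLin : Primal K m₁ m₂ →ₗ[ℝ] Pair (Vec n₁) (Vecs fun _ : Fin K => n₂) where
  toFun z := WithLp.toLp 2 (D.A.toEuclideanLin z.fst,
    WithLp.toLp 2 fun i => (D.A₁ i).toEuclideanLin (z.snd i) + (D.A₂ i).toEuclideanLin z.fst)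
  map_add' x y := by ext <;> simp; ring
  map_smul' t x := by ext <;> simp

/-- The linear part of the conic constraints. -/
noncomputable def conicLin : Primal K m₁ m₂ →ₗ[ℝ] Pair (Vec s₁) (Vecs fun _ : Fin K => s₂) where
  toFun z := WithLp.toLp 2 (D.B.toEuclideanLin z.fst,
    WithLp.toLp 2 fun i => (D.W i).toEuclideanLin (z.snd i) + (D.T i).toEuclideanLin z.fst)
  map_add' x y := by ext <;> simp; ring
  map_smul' t x := by ext <;> simp

/-- The linear part of the constraint mapping. -/
noncomputable def constraintLin : Primal K m₁ m₂ →ₗ[ℝ] Dual K n₁ n₂ s₁ s₂ where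
  toFun z := WithLp.toLp 2 ((D.eqLin z).fst, WithLp.toLp 2 ((D.conicLin z).fst,
    WithLp.toLp 2 ((D.eqLin z).snd, (D.conicLin z).snd)))
  map_add' x y := by simp [← WithLp.toLp_add]
  map_smul' t x := by simp [← WithLp.toLp_smul]

theorem constraintLin_apply (z : Primal K m₁ m₂) : D.constraintLin z =
    WithLp.toLp 2 ((D.eqLin z).fst, WithLp.toLp 2 ((D.conicLin z).fst,
      WithLp.toLp 2 ((D.eqLin z).snd, (D.conicLin z).snd))) :=
  rfl

/-- The constant part of the conic constraints. -/
noncomputable def conicConst : Pair (Vec s₁) (Vecs fun _ : Fin K => s₂) :=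
  WithLp.toLp 2 (-D.b, WithLp.toLp 2 fun i => -D.h i)

/-- The product of the cones `-C₁` and `-(C₂ i)`. -/
noncomputable def conicCone : ConvexCone ℝ (Pair (Vec s₁) (Vecs fun _ : Fin K => s₂)) where
  carrier := {w | w.fst ∈ -(D.C₁ : Set (Vec s₁)) ∧ ∀ i, w.snd i ∈ -(D.C₂ i : Set (Vec s₂))}
  smul_mem' t ht x hx := by
    refine ⟨?_, fun i => ?_⟩
    · simpa using D.C₁.smul_mem hx.1 ht.le
    · simpa using (D.C₂ i).smul_mem (hx.2 i) ht.le
  add_mem' x hx y hy := by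
    refine ⟨?_, fun i => ?_⟩
    · simpa [add_comm] using D.C₁.add_mem hx.1 hy.1
    · simpa [add_comm] using (D.C₂ i).add_mem (hx.2 i) (hy.2 i)

theorem mem_conicCone {w : Pair (Vec s₁) (Vecs fun _ : Fin K => s₂)} : w ∈ D.conicCone ↔
    w.fst ∈ -(D.C₁ : Set (Vec s₁)) ∧ ∀ i, w.snd i ∈ -(D.C₂ i : Set (Vec s₂)) := Iff.rfl

theorem zero_mem_conicCone : 0 ∈ D.conicCone := by
  simp [mem_conicCone]

theorem mem_interior_conicCone {w : Pair (Vec s₁) (Vecs fun _ : Fin K => s₂)}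
    (h₁ : w.fst ∈ interior (-(D.C₁ : Set (Vec s₁))))
    (h₂ : ∀ i, w.snd i ∈ interior (-(D.C₂ i : Set (Vec s₂)))) :
    w ∈ interior (D.conicCone : Set (Pair (Vec s₁) (Vecs fun _ : Fin K => s₂))) := by
  have h : IsOpen {w : Pair (Vec s₁) (Vecs fun _ : Fin K => s₂) |
      w.fst ∈ interior (-(D.C₁ : Set (Vec s₁))) ∧
      ∀ i, w.snd i ∈ interior (-(D.C₂ i : Set (Vec s₂)))} := by
    simp only [Set.ofPred_and, Set.ofPred_forall]
    refine (isOpen_interior.preimage (by fun_prop)).inter (isOpen_iInter_of_finite fun i => ?_)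
    exact isOpen_interior.preimage (by fun_prop)
  exact interior_maximal (fun w hw => D.mem_conicCone.2
      ⟨interior_subset hw.1, fun i => interior_subset (hw.2 i)⟩) h
    ⟨h₁, h₂⟩

theorem 𝒰_sub (z z' : Primal K m₁ m₂) : D.𝒰 z' - D.𝒰 z = D.innerLin (z' - z) := by
  rw [map_sub]
  ext <;> simp [𝒰, innerLin]

theorem G_sub (z z' : Primal K m₁ m₂) : D.G z' - D.G z = D.constraintLin (z' - z) := by
  rw [map_sub]
  ext <;> simp [G, constraintLin, eqLin, conicLin]

/-- A feasible reference point replaces the right-hand sides of the equations, as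
`exists_lagrange_multiplier` requires. -/
theorem mem_Φ_iff_of_mem {z z' : Primal K m₁ m₂} (hz : z ∈ D.Φ) :
    z' ∈ D.Φ ↔ D.eqLin z' = D.eqLin z ∧ D.conicLin z' + D.conicConst ∈ D.conicCone := by
  have h1 : ∀ w : Primal K m₁ m₂, D.conicLin w + D.conicConst ∈ D.conicCone ↔
      D.B.toEuclideanLin w.fst - D.b ∈ -(D.C₁ : Set (Vec s₁)) ∧
      ∀ i, (D.W i).toEuclideanLin (w.snd i) + (D.T i).toEuclideanLin w.fst - D.h i ∈
        -(D.C₂ i : Set (Vec s₂)) := fun w => by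
    simp [mem_conicCone, conicLin, conicConst, sub_eq_add_neg]
  have h2 : D.eqLin z' = D.eqLin z ↔ D.A.toEuclideanLin z'.fst = D.a ∧
      ∀ i, (D.A₁ i).toEuclideanLin (z'.snd i) + (D.A₂ i).toEuclideanLin z'.fst = D.d i := by
    have h3 : D.eqLin z = WithLp.toLp 2 (D.a, WithLp.toLp 2 D.d) := by
      simp only [eqLin, LinearMap.coe_mk, AddHom.coe_mk, hz.1.1, fun i => (hz.2 i).1]
    rw [h3]
    simp [eqLin, funext_iff, (WithLp.toLp_injective 2).eq_iff]
  rw [h1, h2]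
  simp only [Φ, X, Y, Set.mem_ofPred_eq, forall_and]
  tauto

theorem convex_Φ : Convex ℝ D.Φ := by
  intro x hx y hy a b ha hb hab
  have hy' := (D.mem_Φ_iff_of_mem hx).1 hy
  have hx' := (D.mem_Φ_iff_of_mem hx).1 hx
  refine (D.mem_Φ_iff_of_mem hx).2 ⟨?_, ?_⟩
  · rw [map_add, map_smul, map_smul, hy'.1, ← add_smul, hab, one_smul]
  · have := D.conicCone.convex hx'.2 hy'.2 ha hb hab
    refine (congrArg (· ∈ D.conicCone) ?_).mpr this
    rw [map_add, map_smul, map_smul]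
    nth_rw 1 [show D.conicConst = a • D.conicConst + b • D.conicConst by
      rw [← add_smul, hab, one_smul]]
    module

theorem hasFDerivAt_of_sub_eq {E F : Type*} [NormedAddCommGroup E] [NormedSpace ℝ E]
    [NormedAddCommGroup F] [NormedSpace ℝ F] {L : E → F} {L₀ : E →L[ℝ] F}
    (hL : ∀ z z', L z' - L z = L₀ (z' - z)) (z : E) : HasFDerivAt L L₀ z := by
  have : L = fun z => L₀ z + L 0 := by
    funext z
    rw [← sub_eq_iff_eq_add, hL, sub_zero]
  rw [this]
  exact L₀.hasFDerivAt.add_const _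

theorem gradMap_𝒰 (z : Primal K m₁ m₂) :
    gradMap D.𝒰 z = ContinuousLinearMap.adjoint (LinearMap.toContinuousLinearMap D.innerLin) := by
  rw [gradMap, (hasFDerivAt_of_sub_eq (L₀ := LinearMap.toContinuousLinearMap D.innerLin)
    D.𝒰_sub z).fderiv]

theorem gradMap_G (z : Primal K m₁ m₂) : gradMap D.G z =
    ContinuousLinearMap.adjoint (LinearMap.toContinuousLinearMap D.constraintLin) := by
  rw [gradMap, (hasFDerivAt_of_sub_eq (L₀ := LinearMap.toContinuousLinearMap D.constraintLin)
    D.G_sub z).fderiv]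

theorem lowerSemicontinuous_P (hD : D.StandingAssumptions) : LowerSemicontinuous D.P := by
  refine (hD.P₁_lsc.comp (by fun_prop)).add (lowerSemicontinuous_sum fun i _ => ?_)
  exact (continuous_const_mul (D.p i)).comp_lowerSemicontinuous
    ((hD.P₂_lsc i).comp (by fun_prop)) (monotone_mul_left_of_nonneg (hD.p_nonneg i))

theorem continuous_𝒰 : Continuous D.𝒰 :=
  continuous_iff_continuousAt.2 fun z => (hasFDerivAt_of_sub_eq
    (L₀ := LinearMap.toContinuousLinearMap D.innerLin) D.𝒰_sub z).continuousAt

theorem contDiff_fHat (hD : D.StandingAssumptions) : ContDiff ℝ 1 D.fHat := by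
  have h1 := hD.c_smooth.of_le (m := 1) (by norm_num)
  have h2 := fun i => (hD.q_smooth i).of_le (m := 1) (by norm_num)
  have h3 : ContDiff ℝ 1 fun z : Primal K m₁ m₂ => z.fst :=
    (WithLp.fstL 2 ℝ (Vec m₁) (Vecs fun _ : Fin K => m₂)).contDiff
  have h4 : ∀ i, ContDiff ℝ 1 fun z : Primal K m₁ m₂ => z.snd i := fun i =>
    ((PiLp.proj 2 (fun _ : Fin K => Vec m₂) i).comp
      (WithLp.sndL 2 ℝ (Vec m₁) (Vecs fun _ : Fin K => m₂))).contDiff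
  exact (h1.comp h3).add (ContDiff.sum fun i _ => contDiff_const.mul ((h2 i).comp (h4 i)))

/-- Under the Slater condition every normal vector to `Φ` comes from a normal vector to `𝒦`. -/
theorem exists_gradMap_G_eq (hD : D.StandingAssumptions) {z v : Primal K m₁ m₂}
    (hv : v ∈ limitingNormalCone D.Φ z) :
    ∃ M ∈ limitingNormalCone D.𝒦 (D.G z), gradMap D.G z M = v := by
  have hz : z ∈ D.Φ := hv.1
  obtain ⟨x, y, hA, hA₂, hB, hW⟩ := hD.slater
  set z₁ : Primal K m₁ m₂ := WithLp.toLp 2 (x, WithLp.toLp 2 y) with hz₁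
  have hz₁Φ : z₁ ∈ D.Φ := ⟨⟨hA, interior_subset hB⟩, fun i => ⟨hA₂ i, interior_subset (hW i)⟩⟩
  obtain ⟨η, ν, hην, hν0, hνC⟩ := exists_lagrange_multiplier
    (LinearMap.toContinuousLinearMap D.eqLin) (LinearMap.toContinuousLinearMap D.conicLin)
    D.conicConst D.conicCone (z₀ := z) (z₁ := z₁) (v := v) D.zero_mem_conicCone
    ((D.mem_Φ_iff_of_mem hz).1 hz).2 ((D.mem_Φ_iff_of_mem hz).1 hz₁Φ).1
    (D.mem_interior_conicCone (by simpa [conicLin, conicConst, hz₁, sub_eq_add_neg] using hB)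
      fun i => by simpa [conicLin, conicConst, hz₁, sub_eq_add_neg] using hW i)
    fun w hw hwC => inner_le_zero_of_mem_limitingNormalCone D.convex_Φ hv
      ((D.mem_Φ_iff_of_mem hz).2 ⟨hw, hwC⟩)
  refine ⟨WithLp.toLp 2 (η.fst, WithLp.toLp 2 (ν.fst, WithLp.toLp 2 (η.snd, ν.snd))), ?_, ?_⟩
  · have hGz := (D.mem_Φ_iff z).1 hz
    refine mem_limitingNormalCone_of_inner_le_zero hGz fun w hw => ?_
    have h1 := hνC (WithLp.toLp 2 (w.snd.fst, w.snd.snd.snd)) ⟨hw.2.1, hw.2.2.2⟩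
    have h2 : D.conicLin z + D.conicConst =
        WithLp.toLp 2 ((D.G z).snd.fst, (D.G z).snd.snd.snd) := by
      ext <;> simp [conicLin, conicConst, G, sub_eq_add_neg]
    have h3 : w.snd.snd.fst = 0 := by ext1 i; exact hw.2.2.1 i
    have h4 : (D.G z).snd.snd.fst = 0 := by ext1 i; exact hGz.2.2.1 i
    rw [LinearMap.coe_toContinuousLinearMap', h2] at hν0
    simp only [Pair.inner_def] at h1 hν0
    rw [inner_sub_right]
    simp only [Pair.inner_def, hw.1, hGz.1, h3, h4, inner_zero_right]
    simp only [WithLp.toLp_fst, WithLp.toLp_snd] at h1 hν0 ⊢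
    linarith
  · rw [gradMap_G]
    refine ext_inner_right ℝ fun w => ?_
    rw [ContinuousLinearMap.adjoint_inner_left, hην]
    simp only [Pair.inner_def, constraintLin_apply, LinearMap.coe_toContinuousLinearMap',
      WithLp.toLp_fst, WithLp.toLp_snd]
    ring

end Data
end TwoStageSCP

theorem mainTheorem2 {K m₁ m₂ n₁ n₂ s₁ s₂ l₁ : ℕ} {l₂ : Fin K → ℕ}
    (D : TwoStageSCP.Data K m₁ m₂ n₁ n₂ s₁ s₂ l₁ l₂) (hD : D.StandingAssumptions)
    (z : TwoStageSCP.Data.Primal K m₁ m₂) (hz : D.IsLocalSolution z)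
    (hBQ : D.BasicQualification z) (hHQ : D.HorizonQualification z) :
    D.IsKKTPoint z := by
  have hΦ : {w | D.G w ∈ D.𝒦} = D.Φ := Set.ext fun w => (D.mem_Φ_iff w).symm
  have hzΦ : z ∈ D.Φ := (D.mem_Φ_iff z).2 hz.1
  have hP := D.lowerSemicontinuous_P hD
  obtain ⟨v, hv, hN⟩ := TwoStageSCP.exists_subgradient_of_isLocalMinOn hD.compact.isClosed
    (D.contDiff_fHat hD) (hP.comp D.continuous_𝒰 : LowerSemicontinuous D.Ψ) hzΦ
    (hΦ ▸ hz.2) hBQ.subset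
  -- `Ψ` is `P ∘ 𝒰` by definition, so `hv` fits the chain rule as it stands.
  obtain ⟨μ, hμ, hμv⟩ := TwoStageSCP.exists_of_mem_limitingSubdiff_comp
    (LinearMap.toContinuousLinearMap D.innerLin) D.𝒰_sub hP (z₀ := z)
    (fun μ hμ h0 => hHQ μ hμ (by rwa [D.gradMap_𝒰])) hv
  obtain ⟨M, hM, hMv⟩ := D.exists_gradMap_G_eq hD hN
  refine ⟨hzΦ, μ, hμ, M, hM, ?_⟩
  -- The sum becomes `∇fHat + v + (-∇fHat - v)`.
  rw [hMv, D.gradMap_𝒰, hμv]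
  abel
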